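/- Let $d\in\{1,2,3\}$, let $\Omega\subset\mathbb R^d$ be a bounded convex polygonal (polyhedral) domain, $0<\alpha<1$, $T>0$, and let $\mu:[0,T]\to\mathbb R$ be bounded. For a triangulation $\mathcal T_h$ of $\Omega$ (a finite conforming partition of $\overline\Omega$ into $d$-simplices) put $$V_h=\{v\in H^1(\Omega): v|_A\in P_1(A)\ \forall A\in\mathcal T_h\},\qquad S_h=\{f\in L^2(\Omega): f|_A\in P_1(A)\ \forall A\in\mathcal T_h\}.$$ For $M\ge 1$ put $\tau=T/M$, $t_m=m\tau$, $\mu^m=\mu(t_m)$, $b_0=\Gamma(2-\alpha)\tau^\alpha$, $d_j=(j+1)^{1-\alpha}-j^{1-\alpha}$, and let, for $1\le m\le M$, $$\bar\partial_\tau^\alpha v^m=\frac1{\Gamma(2-\alpha)\tau^\alpha}\sum_{j=0}^{m}\gamma_j v^{m-j},\qquad \gamma_0=1,\quad \gamma_j=(j+1)^{1-\alpha}-2j^{1-\alpha}+(j-1)^{1-\alpha}\ (1\le j\le m-1),\quad \gamma_m=(m-1)^{1-\alpha}-m^{1-\alpha}.$$ Let $(\cdot,\cdot)$ be the $L^2(\Omega)$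 inner product. Given $f_h\in S_h$, consider the fully discrete scheme (for the problem $(\partial_t^\alpha-\Delta+1)u=f\mu$ with homogeneous Neumann boundary condition and $u(\cdot,0)=0$): $u_h^0=0$, and $u_h^{1},\dots,u_h^M\in V_h$ satisfy, for all $\chi_h\in V_h$ and $0\le m\le M-1$, $$(1+b_0)(u_h^{m+1},\chi_h)+b_0(\nabla u_h^{m+1},\nabla\chi_h)=\sum_{j=0}^{m-1}(d_j-d_{j+1})(u_h^{m-j},\chi_h)+b_0(f_h\mu^{m+1},\chi_h),\tag{A}$$ or, equivalently, for all $\chi_h\in V_h$ and $1\le m\le M$, $$(\bar\partial_\tau^\alpha u_h^m,\chi_h)+(\nabla u_h^m,\nabla\chi_h)+(u_h^m,\chi_h)=(f_h\mu^m,\chi_h).\tag{B}$$ **Lemma.** For every triangulation $\mathcal T_h$ of $\Omega$, every $M\ge1$ and every $f_h\in S_h$, the two forms (with $u_h^0=0$) are equivalent and have exactly one solution $u_h^m=u_h^m(f_h)$, $0\le m\le M$. The scheme is unconditionally stable: there is a constant $C>0$, independent of the triangulation (in particular of $h$) and of $\tau$, such that for all $f_h,g_h\in S_h$ and all $(u_h^m)_{m=0}^M$,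 $(w_h^m)_{m=0}^M$ in $V_h$ with arbitrary initial values $u_h^0,w_h^0\in V_h$ that satisfy (B) with sources $f_h$ and $g_h$, respectively, $$\|u_h^m-w_h^m\|_{L^2(\Omega)}\le C\bigl(\|u_h^0-w_h^0\|_{L^2(\Omega)}+\|f_h-g_h\|_{L^2(\Omega)}\bigr),\qquad m=1,\dots,M.$$ Moreover, there are constants $C_0,C_1>0$, independent of the triangulation (in particular of $h$) and of $\tau$, such that for all $\mathcal T_h$, $M\ge1$, $f_h\in S_h$ and $m=1,\dots,M$, $$\text{(i)}\ \ \|u_h^m(f_h)\|_{L^2(\Omega)}\le C_0\|f_h\|_{L^2(\Omega)},\qquad \text{(ii)}\ \ \|\nabla u_h^m(f_h)\|_{L^2(\Omega)}^2\le C_1\|f_h\|_{L^2(\Omega)}^2.$$ -/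

import Mathlib

open MeasureTheory Set
open scoped ContDiff

noncomputable section

namespace L1Galerkin

/-- Euclidean space `ℝᵈ`. -/
abbrev Rd (d : ℕ) : Type := EuclideanSpace ℝ (Fin d)

/-- Bounded convex polygonal (polyhedral) domain: a nonempty open convex set whose closure is the
convex hull of finitely many points (boundedness is a consequence). -/
structure IsConvexPolygonalDomain {d : ℕ} (Ω : Set (Rd d)) : Prop where
  isOpen : IsOpen Ω
  nonempty : Ω.Nonempty
  convex : Convex ℝ Ω
  polytope : ∃ s : Finset (Rd d), closure Ω = convexHull ℝ (s : Set (Rd d))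

/-- `L²(Ω)`, with its inner product `(·,·)` and norm. -/
abbrev L2 {d : ℕ} (Ω : Set (Rd d)) : Type := Lp ℝ 2 (volume.restrict Ω)

/-- `L²(Ω; ℝᵈ)`. -/
abbrev L2Vec {d : ℕ} (Ω : Set (Rd d)) : Type := Lp (Rd d) 2 (volume.restrict Ω)

/-- `g` is the weak gradient of `u` in `Ω`. -/
def IsWeakGradient {d : ℕ} (Ω : Set (Rd d)) (u : L2 Ω) (g : L2Vec Ω) : Prop :=
  ∀ φ : Rd d → ℝ, ContDiff ℝ ∞ φ → HasCompactSupport φ → tsupport φ ⊆ Ω → ∀ i : Fin d,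
    ∫ x in Ω, u x * fderiv ℝ φ x (EuclideanSpace.single i 1) = -∫ x in Ω, g x i * φ x

lemma integrable_mul_test {d : ℕ} {Ω : Set (Rd d)} {v ψ : Rd d → ℝ}
    (hv : MemLp v 2 (volume.restrict Ω)) (hψ : Continuous ψ) (hc : HasCompactSupport ψ) :
    Integrable (fun x => v x * ψ x) (volume.restrict Ω) :=
  hv.integrable_mul (q := 2) (hψ.memLp_of_hasCompactSupport hc)

lemma integrable_test_deriv {d : ℕ} {Ω : Set (Rd d)} (u : L2 Ω) {φ : Rd d → ℝ}
    (hφ : ContDiff ℝ ∞ φ) (hc : HasCompactSupport φ) (e : Rd d) :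
    Integrable (fun x => u x * fderiv ℝ φ x e) (volume.restrict Ω) := by
  refine integrable_mul_test (Lp.memLp u) ?_ ?_
  · exact (hφ.continuous_fderiv (by simp)).clm_apply continuous_const
  · exact hc.fderiv_apply ℝ e

lemma integrable_test_coord {d : ℕ} {Ω : Set (Rd d)} (g : L2Vec Ω) {φ : Rd d → ℝ}
    (hφ : ContDiff ℝ ∞ φ) (hc : HasCompactSupport φ) (i : Fin d) :
    Integrable (fun x => g x i * φ x) (volume.restrict Ω) := by
  refine integrable_mul_test ?_ hφ.continuous hc
  exact (EuclideanSpace.proj (𝕜 := ℝ) i).comp_memLp' (Lp.memLp g)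

/-- The Sobolev space `H¹(Ω)`. An element is a pair `(u, ∇u)`: a function `u ∈ L²(Ω)` together
with its weak gradient `∇u ∈ L²(Ω; ℝᵈ)`. -/
def H1 {d : ℕ} (Ω : Set (Rd d)) : Submodule ℝ (L2 Ω × L2Vec Ω) where
  carrier := {p | IsWeakGradient Ω p.1 p.2}
  zero_mem' := by
    intro φ _ _ _ i
    have h1 : ∀ᵐ x ∂(volume.restrict Ω),
        ((0 : L2 Ω) : Rd d → ℝ) x * fderiv ℝ φ x (EuclideanSpace.single i 1) = 0 := by
      filter_upwards [Lp.coeFn_zero ℝ 2 (volume.restrict Ω)] with x hx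
      rw [hx, Pi.zero_apply, zero_mul]
    have h2 : ∀ᵐ x ∂(volume.restrict Ω), ((0 : L2Vec Ω) : Rd d → Rd d) x i * φ x = 0 := by
      filter_upwards [Lp.coeFn_zero (Rd d) 2 (volume.restrict Ω)] with x hx
      rw [hx, Pi.zero_apply, PiLp.zero_apply, zero_mul]
    simp only [Prod.fst_zero, Prod.snd_zero]
    rw [integral_eq_zero_of_ae h1, integral_eq_zero_of_ae h2, neg_zero]
  add_mem' := by
    rintro ⟨u, g⟩ ⟨v, k⟩ hu hv φ hφ hc hs i
    have h1 : ∀ᵐ x ∂(volume.restrict Ω),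
        (u + v : L2 Ω) x * fderiv ℝ φ x (EuclideanSpace.single i 1) =
          u x * fderiv ℝ φ x (EuclideanSpace.single i 1)
            + v x * fderiv ℝ φ x (EuclideanSpace.single i 1) := by
      filter_upwards [Lp.coeFn_add u v] with x hx
      rw [hx, Pi.add_apply, add_mul]
    have h2 : ∀ᵐ x ∂(volume.restrict Ω),
        (g + k : L2Vec Ω) x i * φ x = g x i * φ x + k x i * φ x := by
      filter_upwards [Lp.coeFn_add g k] with x hx
      rw [hx, Pi.add_apply, PiLp.add_apply, add_mul]
    have hu' := hu φ hφ hc hs i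
    have hv' := hv φ hφ hc hs i
    simp only [Prod.mk_add_mk] at hu' hv' ⊢
    rw [integral_congr_ae h1, integral_congr_ae h2,
      integral_add (integrable_test_deriv u hφ hc _) (integrable_test_deriv v hφ hc _),
      integral_add (integrable_test_coord g hφ hc i) (integrable_test_coord k hφ hc i),
      hu', hv', neg_add]
  smul_mem' := by
    rintro c ⟨u, g⟩ hu φ hφ hc hs i
    have h1 : ∀ᵐ x ∂(volume.restrict Ω),
        (c • u : L2 Ω) x * fderiv ℝ φ x (EuclideanSpace.single i 1) =
          c * (u x * fderiv ℝ φ x (EuclideanSpace.single i 1)) := by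
      filter_upwards [Lp.coeFn_smul c u] with x hx
      rw [hx, Pi.smul_apply, smul_eq_mul, mul_assoc]
    have h2 : ∀ᵐ x ∂(volume.restrict Ω), (c • g : L2Vec Ω) x i * φ x = c * (g x i * φ x) := by
      filter_upwards [Lp.coeFn_smul c g] with x hx
      rw [hx, Pi.smul_apply, PiLp.smul_apply, smul_eq_mul, mul_assoc]
    have hu' := hu φ hφ hc hs i
    simp only [Prod.smul_mk] at hu' ⊢
    rw [integral_congr_ae h1, integral_congr_ae h2, integral_const_mul, integral_const_mul,
      hu', mul_neg]

/-- A (conforming, finite) triangulation `𝒯_h` of `Ω`: a finite geometric simplicial complex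
filling the closure of `Ω`. -/
structure Triangulation {d : ℕ} (Ω : Set (Rd d)) where
  complex : Geometry.SimplicialComplex ℝ (Rd d)
  finite : complex.faces.Finite
  space_eq : complex.space = closure Ω

/-- The elements of the triangulation, given by their vertex sets: its `d`-dimensional simplices. -/
def Triangulation.elements {d : ℕ} {Ω : Set (Rd d)} (𝒯 : Triangulation Ω) :
    Set (Finset (Rd d)) :=
  {s | s ∈ 𝒯.complex.faces ∧ s.card = d + 1}

/-- `S_h`: the functions in `L²(Ω)` that agree on each element with an affine function. -/
def Sh {d : ℕ} {Ω : Set (Rd d)} (𝒯 : Triangulation Ω) : Submodule ℝ (L2 Ω) where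
  carrier := {f | ∀ s ∈ 𝒯.elements, ∃ ℓ : Rd d →ᵃ[ℝ] ℝ,
    ∀ᵐ x ∂(volume.restrict Ω), x ∈ convexHull ℝ (s : Set (Rd d)) → f x = ℓ x}
  zero_mem' := by
    intro s _
    refine ⟨0, ?_⟩
    filter_upwards [Lp.coeFn_zero ℝ 2 (volume.restrict Ω)] with x hx _
    rw [hx, AffineMap.coe_zero]
  add_mem' := by
    intro f g hf hg s hs
    obtain ⟨a, ha⟩ := hf s hs
    obtain ⟨b, hb⟩ := hg s hs
    refine ⟨a + b, ?_⟩
    filter_upwards [Lp.coeFn_add f g, ha, hb] with x hx h1 h2 hm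
    rw [hx, Pi.add_apply, h1 hm, h2 hm, AffineMap.coe_add, Pi.add_apply]
  smul_mem' := by
    intro c f hf s hs
    obtain ⟨a, ha⟩ := hf s hs
    refine ⟨c • a, ?_⟩
    filter_upwards [Lp.coeFn_smul c f, ha] with x hx h1 hm
    rw [hx, Pi.smul_apply, h1 hm, AffineMap.coe_smul, Pi.smul_apply]

/-- `V_h`: the functions in `H¹(Ω)` (with their weak gradients) that agree on each element with an
affine function. -/
def Vh {d : ℕ} {Ω : Set (Rd d)} (𝒯 : Triangulation Ω) : Submodule ℝ (L2 Ω × L2Vec Ω) :=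
  H1 Ω ⊓ (Sh 𝒯).comap (LinearMap.fst ℝ (L2 Ω) (L2Vec Ω))

/-- The element of `L²(Ω)` underlying `v ∈ V_h`. -/
def toL2 {d : ℕ} {Ω : Set (Rd d)} {𝒯 : Triangulation Ω} (v : Vh 𝒯) : L2 Ω := v.1.1

/-- The weak gradient `∇v ∈ L²(Ω; ℝᵈ)` of `v ∈ V_h`. -/
def grad {d : ℕ} {Ω : Set (Rd d)} {𝒯 : Triangulation Ω} (v : Vh 𝒯) : L2Vec Ω := v.1.2

/-- `d_j = (j+1)^{1-α} - j^{1-α}`. -/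
def dCoeff (α : ℝ) (j : ℕ) : ℝ := ((j : ℝ) + 1) ^ (1 - α) - (j : ℝ) ^ (1 - α)

/-- The weights `γ_j`, `j = 0, …, n`, of the L1 approximation at time `t_n`, `n ≥ 1`. -/
def gammaCoeff (α : ℝ) (n j : ℕ) : ℝ :=
  if j = 0 then 1
  else if j < n then
    ((j : ℝ) + 1) ^ (1 - α) - 2 * (j : ℝ) ^ (1 - α) + ((j : ℝ) - 1) ^ (1 - α)
  else ((n : ℝ) - 1) ^ (1 - α) - (n : ℝ) ^ (1 - α)

/-- `b₀ = Γ(2-α) τ^α`. -/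
def bZero (α τ : ℝ) : ℝ := Real.Gamma (2 - α) * τ ^ α

/-- The L1 approximation at `t_n`, `n ≥ 1`, of the Caputo derivative of order `α`:
`(Γ(2-α) τ^α)⁻¹ ∑_{j=0}^{n} γ_j v^{n-j}`. -/
def l1Deriv {X : Type*} [AddCommGroup X] [Module ℝ X] (α τ : ℝ) (v : ℕ → X) (n : ℕ) : X :=
  (1 / (Real.Gamma (2 - α) * τ ^ α)) •
    ∑ j ∈ Finset.range (n + 1), gammaCoeff α n j • v (n - j)

/-- The L1–Galerkin equations, without an initial condition, for `u⁰, …, u^M ∈ V_h`: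
`(∂̄_τ^α u^m, χ) + (∇u^m, ∇χ) + (u^m, χ) = (f μ(t_m), χ)` for all `χ ∈ V_h` and `1 ≤ m ≤ M`,
where `τ = T/M` and `t_m = mτ`. Values `u m` with `m > M` are irrelevant. -/
def L1Equations {d : ℕ} {Ω : Set (Rd d)} (𝒯 : Triangulation Ω) (α T : ℝ) (μ : ℝ → ℝ) (M : ℕ)
    (f : L2 Ω) (u : ℕ → Vh 𝒯) : Prop :=
  ∀ m : ℕ, 1 ≤ m → m ≤ M → ∀ χ : Vh 𝒯,
    inner ℝ (toL2 (l1Deriv α (T / M) u m)) (toL2 χ) + inner ℝ (grad (u m)) (grad χ)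
      + inner ℝ (toL2 (u m)) (toL2 χ) = inner ℝ (μ (m * (T / M)) • f) (toL2 χ)

/-- The fully discrete scheme in L1 form: `u⁰ = 0` and the L1–Galerkin equations. -/
def IsL1Solution {d : ℕ} {Ω : Set (Rd d)} (𝒯 : Triangulation Ω) (α T : ℝ) (μ : ℝ → ℝ) (M : ℕ)
    (f : L2 Ω) (u : ℕ → Vh 𝒯) : Prop :=
  u 0 = 0 ∧ L1Equations 𝒯 α T μ M f u

/-- The fully discrete scheme in time-stepping form: `u⁰ = 0` and
`(1 + b₀)(u^{m+1}, χ) + b₀(∇u^{m+1}, ∇χ)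
  = ∑_{j=0}^{m-1} (d_j - d_{j+1})(u^{m-j}, χ) + b₀(f μ(t_{m+1}), χ)`
for all `χ ∈ V_h` and `0 ≤ m ≤ M - 1`. -/
def IsSteppingSolution {d : ℕ} {Ω : Set (Rd d)} (𝒯 : Triangulation Ω) (α T : ℝ) (μ : ℝ → ℝ)
    (M : ℕ) (f : L2 Ω) (u : ℕ → Vh 𝒯) : Prop :=
  u 0 = 0 ∧ ∀ m : ℕ, m < M → ∀ χ : Vh 𝒯,
    (1 + bZero α (T / M)) * inner ℝ (toL2 (u (m + 1))) (toL2 χ)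
        + bZero α (T / M) * inner ℝ (grad (u (m + 1))) (grad χ)
      = ∑ j ∈ Finset.range m,
          (dCoeff α j - dCoeff α (j + 1)) * inner ℝ (toL2 (u (m - j))) (toL2 χ)
        + bZero α (T / M) * inner ℝ (μ ((m + 1 : ℕ) * (T / M)) • f) (toL2 χ)

/-- Unconditional stability: perturbations of the initial value in `V_h` and of the discrete
source in `S_h` are controlled in `L²(Ω)`, at all time levels, with one constant for all
triangulations and all time steps, with no relation imposed between the two. -/
def UnconditionallyStable {d : ℕ} (Ω : Set (Rd d)) (α T : ℝ) (μ : ℝ → ℝ) : Prop :=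
  ∃ C : ℝ, 0 < C ∧ ∀ (𝒯 : Triangulation Ω) (M : ℕ), 0 < M →
    ∀ f ∈ Sh 𝒯, ∀ g ∈ Sh 𝒯, ∀ u w : ℕ → Vh 𝒯,
      L1Equations 𝒯 α T μ M f u → L1Equations 𝒯 α T μ M g w →
        ∀ m : ℕ, 1 ≤ m → m ≤ M →
          ‖toL2 (u m) - toL2 (w m)‖ ≤ C * (‖toL2 (u 0) - toL2 (w 0)‖ + ‖f - g‖)

end L1Galerkin

end

/-!
The scheme is an implicit time stepping in which the weights of the past values are nonnegative and
sum to one: the increments `d_j = (j+1)^{1-α} - j^{1-α}` decrease from `d_0 = 1`, so that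
`l1History α v m = ∑_{j<m} (d_j - d_{j+1}) v^{m-j} + d_m v^0` is a convex combination of
`v^0, …, v^m`, and `b₀ ∂̄_τ^α v^{m+1} = v^{m+1} - l1History α v m` (`bZero_smul_l1Deriv_succ`).
Multiplying by `b₀` turns one form of the scheme into the other.

*Solvability.* Each step asks for the Riesz representative of an `L²` functional on `V_h` with
respect to the weighted energy inner product `(1 + b₀)(u, χ) + b₀(∇u, ∇χ)`. The weighted copy of
`V_h` in `L² × L²` is closed (`isClosed_Vh`), hence the representative is an orthogonal projection
(`exists_energy_solution`); uniqueness follows from the two bounds below, applied to a difference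
(`IsL1Solution.eq`).

*Stability in `L²`.* Testing with `χ = u^{m+1}` gives
`(1 + b₀)‖u^{m+1}‖ ≤ max_{k ≤ m} ‖u^k‖ + b₀ K ‖f‖` with `K` a bound of `|μ|`, and by induction
`‖u^m‖ ≤ ‖u^0‖ + K‖f‖` (`L1Equations.norm_toL2_le`).

*Bound of the gradient.* Testing with `χ = u^m` would leave a factor `τ^{-α}`. Testing with
`χ = ∂̄_τ^α u^{m+1}` and absorbing that term gives `(u^{m+1}, ∂̄_τ^α u^{m+1})_{H¹} ≤ K²‖f‖²/4`,
and convexity of the square turns this into `∂̄_τ^α ‖u‖²_{H¹} ≤ K²‖f‖²/2`. A discrete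
fractional comparison (`mul_dCoeff_le_of_le_l1History`) bounds `‖u^{m+1}‖²_{H¹}` by
`b₀ d_m⁻¹ K²‖f‖²/2`, where `b₀ d_m⁻¹ ≤ Γ(2-α) T^α / (1-α)` since `d_m ≥ (1-α)(m+1)^{-α}`.
-/

namespace L1Galerkin

/-! ### The weights of the L1 approximation -/

lemma dCoeff_zero {α : ℝ} (hα1 : α < 1) : dCoeff α 0 = 1 := by
  have : (1 - α) ≠ 0 := by linarith
  simp [dCoeff, Real.zero_rpow this]

/-- Concavity of `x ↦ x^{1-α}`. -/
lemma dCoeff_succ_le {α : ℝ} (hα0 : 0 < α) (hα1 : α < 1) (j : ℕ) :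
    dCoeff α (j + 1) ≤ dCoeff α j := by
  have hc := Real.concaveOn_rpow (p := 1 - α) (by linarith) (by linarith)
  have hj : (0 : ℝ) ≤ j := j.cast_nonneg
  have hmem : (j : ℝ) + 2 ∈ Ici (0 : ℝ) := by
    rw [mem_Ici]
    linarith
  have h := hc.2 (mem_Ici.2 hj) hmem (by norm_num : (0 : ℝ) ≤ 1 / 2)
    (by norm_num : (0 : ℝ) ≤ 1 / 2) (by norm_num)
  simp only [smul_eq_mul] at h
  rw [show (1 / 2 : ℝ) * j + 1 / 2 * (j + 2) = j + 1 by ring] at h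
  simp only [dCoeff]
  push_cast
  rw [show (j : ℝ) + 1 + 1 = j + 2 by ring]
  linarith

lemma dCoeff_antitone {α : ℝ} (hα0 : 0 < α) (hα1 : α < 1) : Antitone (dCoeff α) :=
  antitone_nat_of_succ_le (dCoeff_succ_le hα0 hα1)

/-- Bernoulli's inequality for `(1 - 1/(m+1))^{1-α}`. -/
lemma le_dCoeff {α : ℝ} (hα0 : 0 < α) (hα1 : α < 1) (m : ℕ) :
    (1 - α) / ((m : ℝ) + 1) ^ α ≤ dCoeff α m := by
  have hm : (0 : ℝ) < (m : ℝ) + 1 := by positivity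
  have hs : (-1 : ℝ) ≤ -(1 / ((m : ℝ) + 1)) := by
    rw [neg_le_neg_iff, div_le_one hm]
    linarith [(m.cast_nonneg : (0 : ℝ) ≤ m)]
  have hB := rpow_one_add_le_one_add_mul_self hs (p := 1 - α) (by linarith) (by linarith)
  have hsplit : (m : ℝ) ^ (1 - α)
      = ((m : ℝ) + 1) ^ (1 - α) * (1 + -(1 / ((m : ℝ) + 1))) ^ (1 - α) := by
    rw [← Real.mul_rpow hm.le (by linarith)]
    congr 1
    field_simp
    ring
  have hpow : ((m : ℝ) + 1) ^ (1 - α) = ((m : ℝ) + 1) / ((m : ℝ) + 1) ^ α := by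
    rw [Real.rpow_sub hm, Real.rpow_one]
  have hpos : 0 < ((m : ℝ) + 1) ^ α := Real.rpow_pos_of_pos hm _
  have hle := mul_le_mul_of_nonneg_left hB (Real.rpow_nonneg hm.le (1 - α))
  rw [← hsplit] at hle
  have : ((m : ℝ) + 1) ^ (1 - α) * (1 + (1 - α) * -(1 / ((m : ℝ) + 1)))
      = ((m : ℝ) + 1) ^ (1 - α) - (1 - α) / ((m : ℝ) + 1) ^ α := by
    rw [hpow]
    field_simp
    ring
  rw [this] at hle
  simp only [dCoeff]
  linarith

lemma dCoeff_pos {α : ℝ} (hα0 : 0 < α) (hα1 : α < 1) (m : ℕ) : 0 < dCoeff α m :=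
  lt_of_lt_of_le (div_pos (by linarith) (by positivity)) (le_dCoeff hα0 hα1 m)

lemma sum_dCoeff_sub {α : ℝ} (hα1 : α < 1) (m : ℕ) :
    ∑ j ∈ Finset.range m, (dCoeff α j - dCoeff α (j + 1)) = 1 - dCoeff α m := by
  rw [Finset.sum_range_sub', dCoeff_zero hα1]

lemma bZero_pos {α τ : ℝ} (hα1 : α < 1) (hτ : 0 < τ) : 0 < bZero α τ :=
  mul_pos (Real.Gamma_pos_of_pos (by linarith)) (Real.rpow_pos_of_pos hτ _)

/-- The accumulated weight of the source remains bounded up to the final time. -/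
lemma bZero_le_mul_dCoeff {α T : ℝ} (hα0 : 0 < α) (hα1 : α < 1) (hT : 0 < T) {m M : ℕ}
    (hm : m < M) :
    bZero α (T / M) ≤ Real.Gamma (2 - α) * T ^ α / (1 - α) * dCoeff α m := by
  have hM : (0 : ℝ) < M := by exact_mod_cast (Nat.zero_le m).trans_lt hm
  have hΓ : 0 < Real.Gamma (2 - α) := Real.Gamma_pos_of_pos (by linarith)
  have h1α : 0 < 1 - α := by linarith
  have hTα : 0 < T ^ α := Real.rpow_pos_of_pos hT _
  have hmM : ((m : ℝ) + 1) ^ α ≤ (M : ℝ) ^ α :=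
    Real.rpow_le_rpow (by positivity) (by exact_mod_cast hm) hα0.le
  have hmpos : 0 < ((m : ℝ) + 1) ^ α := by positivity
  calc bZero α (T / M) = Real.Gamma (2 - α) * (T ^ α / (M : ℝ) ^ α) := by
        rw [bZero, Real.div_rpow hT.le hM.le]
    _ ≤ Real.Gamma (2 - α) * (T ^ α / ((m : ℝ) + 1) ^ α) := by gcongr
    _ = Real.Gamma (2 - α) * T ^ α / (1 - α) * ((1 - α) / ((m : ℝ) + 1) ^ α) := by
        field_simp
    _ ≤ _ := by
        gcongr
        exact le_dCoeff hα0 hα1 m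

/-! ### The history term as a convex combination -/

/-- The convex combination `∑_{j<m} (d_j - d_{j+1}) v^{m-j} + d_m v^0` of the values up to `t_m`
through which the past enters the step from `t_m` to `t_{m+1}`. -/
noncomputable def l1History {X : Type*} [AddCommGroup X] [Module ℝ X] (α : ℝ) (v : ℕ → X)
    (m : ℕ) : X :=
  ∑ j ∈ Finset.range m, (dCoeff α j - dCoeff α (j + 1)) • v (m - j) + dCoeff α m • v 0

section History

variable {X Y : Type*} [AddCommGroup X] [Module ℝ X] [AddCommGroup Y] [Module ℝ Y]

lemma map_l1History (F : X →ₗ[ℝ] Y) (α : ℝ) (v : ℕ → X) (m : ℕ) :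
    F (l1History α v m) = l1History α (fun k => F (v k)) m := by
  simp [l1History, map_sum]

lemma map_l1Deriv (F : X →ₗ[ℝ] Y) (α τ : ℝ) (v : ℕ → X) (n : ℕ) :
    F (l1Deriv α τ v n) = l1Deriv α τ (fun k => F (v k)) n := by
  simp [l1Deriv, map_sum]

lemma l1History_sub (α : ℝ) (v w : ℕ → X) (m : ℕ) :
    l1History α (v - w) m = l1History α v m - l1History α w m := by
  simp only [l1History, Pi.sub_apply, smul_sub, Finset.sum_sub_distrib]
  abel

lemma l1History_add (α : ℝ) (v w : ℕ → X) (m : ℕ) :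
    l1History α (fun k => v k + w k) m = l1History α v m + l1History α w m := by
  simp only [l1History, smul_add, Finset.sum_add_distrib]
  abel

lemma l1History_const {α : ℝ} (hα1 : α < 1) (x : X) (m : ℕ) :
    l1History α (fun _ => x) m = x := by
  rw [l1History, ← Finset.sum_smul, ← add_smul, sum_dCoeff_sub hα1, sub_add_cancel, one_smul]

lemma l1History_mono {α : ℝ} (hα0 : 0 < α) (hα1 : α < 1) {x y : ℕ → ℝ} {m : ℕ}
    (h : ∀ k ≤ m, x k ≤ y k) : l1History α x m ≤ l1History α y m := by
  simp only [l1History, smul_eq_mul]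
  refine add_le_add (Finset.sum_le_sum fun j _ => ?_) ?_
  · exact mul_le_mul_of_nonneg_left (h _ (Nat.sub_le _ _))
      (sub_nonneg.2 (dCoeff_succ_le hα0 hα1 j))
  · exact mul_le_mul_of_nonneg_left (h _ (Nat.zero_le _)) (dCoeff_pos hα0 hα1 m).le

lemma norm_l1History_le {E : Type*} [NormedAddCommGroup E] [NormedSpace ℝ E] {α : ℝ} (hα0 : 0 < α)
    (hα1 : α < 1) {v : ℕ → E} {m : ℕ} {R : ℝ} (h : ∀ k ≤ m, ‖v k‖ ≤ R) :
    ‖l1History α v m‖ ≤ R := by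
  refine le_trans ?_ ((l1History_mono hα0 hα1 h).trans_eq (l1History_const hα1 R m))
  refine (norm_add_le _ _).trans (add_le_add ((norm_sum_le _ _).trans ?_) ?_)
  · refine Finset.sum_le_sum fun j _ => ?_
    rw [norm_smul, Real.norm_of_nonneg (sub_nonneg.2 (dCoeff_succ_le hα0 hα1 j)), smul_eq_mul]
  · rw [norm_smul, Real.norm_of_nonneg (dCoeff_pos hα0 hα1 m).le, smul_eq_mul]

lemma bZero_smul_l1Deriv_succ {α τ : ℝ} (hb : bZero α τ ≠ 0) (v : ℕ → X) (m : ℕ) :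
    bZero α τ • l1Deriv α τ v (m + 1) = v (m + 1) - l1History α v m := by
  have hsum : ∑ j ∈ Finset.range m, gammaCoeff α (m + 1) (j + 1) • v (m + 1 - (j + 1))
      = -∑ j ∈ Finset.range m, (dCoeff α j - dCoeff α (j + 1)) • v (m - j) := by
    rw [← Finset.sum_neg_distrib]
    refine Finset.sum_congr rfl fun j hj => ?_
    have hj' : j + 1 < m + 1 := by simpa using hj
    rw [gammaCoeff, if_neg j.succ_ne_zero, if_pos hj', ← neg_smul, Nat.add_sub_add_right]
    congr 1
    simp only [dCoeff]
    push_cast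
    rw [add_sub_cancel_right]
    ring
  have hlast : gammaCoeff α (m + 1) (m + 1) = -dCoeff α m := by
    rw [gammaCoeff, if_neg m.succ_ne_zero, if_neg (lt_irrefl _)]
    simp only [dCoeff]
    push_cast
    rw [add_sub_cancel_right]
    ring
  have hfirst : gammaCoeff α (m + 1) 0 = 1 := by simp [gammaCoeff]
  rw [l1Deriv, ← bZero, smul_smul, mul_one_div_cancel hb, one_smul, Finset.sum_range_succ',
    Finset.sum_range_succ, hsum, hlast, hfirst, l1History, Nat.sub_self, Nat.sub_zero, one_smul,
    neg_smul]
  abel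

/-- The discrete counterpart of `∂_t^α ‖v‖² ≤ 2 (v, ∂_t^α v)`. -/
lemma norm_sq_sub_l1History_le {E : Type*} [NormedAddCommGroup E] [InnerProductSpace ℝ E] {α : ℝ}
    (hα0 : 0 < α) (hα1 : α < 1) (v : ℕ → E) (m : ℕ) :
    ‖v (m + 1)‖ ^ 2 - l1History α (fun k => ‖v k‖ ^ 2) m
      ≤ 2 * inner ℝ (v (m + 1)) (v (m + 1) - l1History α v m) := by
  have h1 : 2 * inner ℝ (v (m + 1)) (l1History α v m)
      = l1History α (fun k => 2 * inner ℝ (v (m + 1)) (v k)) m := by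
    simpa using map_l1History ((2 : ℝ) • innerₗ E (v (m + 1))) α v m
  have h2 := l1History_mono hα0 hα1 (m := m) (x := fun k => 2 * inner ℝ (v (m + 1)) (v k))
    (y := fun k => ‖v (m + 1)‖ ^ 2 + ‖v k‖ ^ 2) fun k _ => by
      have := norm_sub_sq_real (v (m + 1)) (v k)
      nlinarith [sq_nonneg ‖v (m + 1) - v k‖]
  rw [l1History_add, l1History_const hα1, ← h1] at h2
  rw [inner_sub_right, real_inner_self_eq_norm_sq]
  linarith

/-- Comparison principle for the discrete fractional derivative: if `E⁰ = 0` and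
`E^{k+1} ≤ l1History E k + R` up to `t_M`, then `E^{m+1} ≤ R / d_m`. -/
lemma mul_dCoeff_le_of_le_l1History {α : ℝ} (hα0 : 0 < α) (hα1 : α < 1) {E : ℕ → ℝ} {M : ℕ} {R : ℝ}
    (hR : 0 ≤ R) (hE0 : E 0 = 0) (hE : ∀ m < M, E (m + 1) ≤ l1History α E m + R) :
    ∀ m < M, E (m + 1) * dCoeff α m ≤ R := by
  intro m
  induction m using Nat.strong_induction_on with
  | _ m ih =>
    intro hm
    have hd := dCoeff_pos hα0 hα1 m
    have hpast : ∀ j ∈ Finset.range m, (dCoeff α j - dCoeff α (j + 1)) • E (m - j)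
        ≤ (dCoeff α j - dCoeff α (j + 1)) * (R / dCoeff α m) := by
      intro j hj
      have hjm : j < m := by simpa using hj
      obtain ⟨k, hk⟩ : ∃ k, m - j = k + 1 := ⟨m - j - 1, by omega⟩
      rw [smul_eq_mul, hk]
      refine mul_le_mul_of_nonneg_left ?_ (sub_nonneg.2 (dCoeff_succ_le hα0 hα1 j))
      have hkd := dCoeff_pos hα0 hα1 k
      calc E (k + 1) ≤ R / dCoeff α k := by
            rw [le_div_iff₀ hkd]
            exact ih k (by omega) (by omega)
        _ ≤ R / dCoeff α m :=
            div_le_div_of_nonneg_left hR hd (dCoeff_antitone hα0 hα1 (by omega))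
    have hsum := Finset.sum_le_sum hpast
    rw [← Finset.sum_mul, sum_dCoeff_sub hα1] at hsum
    have hstep := hE m hm
    rw [l1History, hE0, smul_zero, add_zero] at hstep
    have hfinal : E (m + 1) ≤ R / dCoeff α m := by
      have : (1 - dCoeff α m) * (R / dCoeff α m) + R = R / dCoeff α m := by
        field_simp
        ring
      linarith
    rwa [le_div_iff₀ hd] at hfinal

end History

/-! ### The finite element space is closed -/

section Closed

variable {d : ℕ} {Ω : Set (Rd d)}

lemma integral_mul_eq_inner_toLp (u : L2 Ω) {ψ : Rd d → ℝ}
    (hψ : MemLp ψ 2 (volume.restrict Ω)) :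
    ∫ x in Ω, u x * ψ x = inner ℝ (hψ.toLp ψ) u := by
  rw [L2.inner_def]
  refine integral_congr_ae ?_
  filter_upwards [hψ.coeFn_toLp] with x hx
  simp [hx]

lemma integral_coord_mul_eq_inner_toLp (g : L2Vec Ω) (i : Fin d) {ψ : Rd d → ℝ}
    (hψ : MemLp (fun x => EuclideanSpace.single i (ψ x)) 2 (volume.restrict Ω)) :
    ∫ x in Ω, g x i * ψ x = inner ℝ (hψ.toLp _) g := by
  rw [L2.inner_def]
  refine integral_congr_ae ?_
  filter_upwards [hψ.coeFn_toLp] with x hx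
  simp [hx, EuclideanSpace.inner_single_left, mul_comm]

lemma memLp_test {ψ : Rd d → ℝ} (hψ : Continuous ψ) (hc : HasCompactSupport ψ) :
    MemLp ψ 2 (volume.restrict Ω) :=
  hψ.memLp_of_hasCompactSupport hc

lemma memLp_single_test {ψ : Rd d → ℝ} (hψ : Continuous ψ) (hc : HasCompactSupport ψ) (i : Fin d) :
    MemLp (fun x => EuclideanSpace.single i (ψ x)) 2 (volume.restrict Ω) := by
  have : (fun x => EuclideanSpace.single i (ψ x))
      = fun x => ψ x • (EuclideanSpace.single i (1 : ℝ) : Rd d) := by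
    funext x
    ext k
    by_cases hk : k = i <;> simp [hk]
  rw [this]
  exact (hψ.smul continuous_const).memLp_of_hasCompactSupport hc.smul_right

/-- The weak gradient identity for a fixed test function equates two continuous functionals. -/
lemma isClosed_H1 : IsClosed (H1 Ω : Set (L2 Ω × L2Vec Ω)) := by
  have hset : (H1 Ω : Set (L2 Ω × L2Vec Ω)) = {p | IsWeakGradient Ω p.1 p.2} := rfl
  simp only [hset, IsWeakGradient, ofPred_forall]
  refine isClosed_iInter fun φ => isClosed_iInter fun hφ => isClosed_iInter fun hc =>
    isClosed_iInter fun _ => isClosed_iInter fun i => ?_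
  have h1 : MemLp (fun x => fderiv ℝ φ x (EuclideanSpace.single i 1)) 2 (volume.restrict Ω) :=
    memLp_test ((hφ.continuous_fderiv (by simp)).clm_apply continuous_const)
      (hc.fderiv_apply ℝ _)
  have h2 := memLp_single_test (Ω := Ω) hφ.continuous hc i
  simp only [integral_mul_eq_inner_toLp _ h1, integral_coord_mul_eq_inner_toLp _ i h2]
  exact isClosed_eq (continuous_const.inner continuous_fst)
    (continuous_const.inner continuous_snd).neg

/-- The functions in `L²(ν)` that agree almost everywhere with an affine function. -/
def affineLp (ν : Measure (Rd d)) : Submodule ℝ (Lp ℝ 2 ν) where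
  carrier := {g | ∃ ℓ : Rd d →ᵃ[ℝ] ℝ, g =ᵐ[ν] ℓ}
  zero_mem' := ⟨0, by simpa using Lp.coeFn_zero ℝ 2 ν⟩
  add_mem' := by
    rintro f g ⟨a, ha⟩ ⟨b, hb⟩
    refine ⟨a + b, ?_⟩
    filter_upwards [Lp.coeFn_add f g, ha, hb] with x hx h1 h2
    rw [hx, Pi.add_apply, h1, h2, AffineMap.coe_add, Pi.add_apply]
  smul_mem' := by
    rintro c f ⟨a, ha⟩
    refine ⟨c • a, ?_⟩
    filter_upwards [Lp.coeFn_smul c f, ha] with x hx h1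
    rw [hx, Pi.smul_apply, h1, AffineMap.coe_smul, Pi.smul_apply]

/-- If affine functions are square integrable, their classes form a finite-dimensional space. -/
lemma isClosed_affineLp {ν : Measure (Rd d)} (hν : ∀ ℓ : Rd d →ᵃ[ℝ] ℝ, MemLp ℓ 2 ν) :
    IsClosed (affineLp ν : Set (Lp ℝ 2 ν)) := by
  let F : (Rd d →ᵃ[ℝ] ℝ) →ₗ[ℝ] Lp ℝ 2 ν :=
    { toFun := fun ℓ => (hν ℓ).toLp ℓ
      map_add' := fun a b => (hν a).toLp_add (hν b)
      map_smul' := fun c a => (hν a).toLp_const_smul c }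
  have hF : affineLp ν = LinearMap.range F := by
    ext g
    constructor
    · rintro ⟨ℓ, hℓ⟩
      exact ⟨ℓ, Lp.ext ((hν ℓ).coeFn_toLp.trans hℓ.symm)⟩
    · rintro ⟨ℓ, rfl⟩
      exact ⟨ℓ, (hν ℓ).coeFn_toLp⟩
  have : Module.Finite ℝ (Rd d →ᵃ[ℝ] ℝ) :=
    Module.Finite.equiv (AffineMap.toConstProdLinearMap ℝ (k := ℝ) (V1 := Rd d) (V2 := ℝ)).symm
  rw [hF]
  exact Submodule.closed_of_finiteDimensional _

lemma memLp_affine_of_isCompact {K : Set (Rd d)} (hK : IsCompact K) (ℓ : Rd d →ᵃ[ℝ] ℝ) :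
    MemLp ℓ 2 ((volume.restrict Ω).restrict K) := by
  have : IsFiniteMeasure ((volume.restrict Ω).restrict K) :=
    isFiniteMeasure_restrict.2 hK.measure_lt_top.ne
  have hℓ : Continuous ℓ := ℓ.continuous_of_finiteDimensional
  obtain ⟨C, hC⟩ := hK.exists_bound_of_continuousOn hℓ.continuousOn
  refine MemLp.of_bound hℓ.aestronglyMeasurable C ?_
  filter_upwards [ae_restrict_mem hK.measurableSet] with x hx using hC x hx

lemma isClosed_Sh (𝒯 : Triangulation Ω) : IsClosed (Sh 𝒯 : Set (L2 Ω)) := by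
  have hcompact : ∀ s : Finset (Rd d), IsCompact (convexHull ℝ (s : Set (Rd d))) :=
    fun s => s.finite_toSet.isCompact_convexHull ℝ
  have hset : (Sh 𝒯 : Set (L2 Ω)) = ⋂ s ∈ 𝒯.elements,
      LpToLpRestrictCLM (Rd d) ℝ ℝ (volume.restrict Ω) 2 (convexHull ℝ (s : Set (Rd d))) ⁻¹'
        (affineLp ((volume.restrict Ω).restrict (convexHull ℝ (s : Set (Rd d)))) : Set _) := by
    ext f
    simp only [mem_iInter, mem_preimage, SetLike.mem_coe]
    refine forall₂_congr fun s _ => exists_congr fun ℓ => ?_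
    rw [← ae_restrict_iff' (hcompact s).measurableSet]
    have hr := LpToLpRestrictCLM_coeFn ℝ (convexHull ℝ (s : Set (Rd d))) f
    exact ⟨fun h => hr.trans h, fun h => hr.symm.trans h⟩
  rw [hset]
  exact isClosed_biInter fun s _ =>
    (isClosed_affineLp (memLp_affine_of_isCompact (hcompact s))).preimage
      (LpToLpRestrictCLM _ _ _ _ _ _).continuous

lemma isClosed_Vh (𝒯 : Triangulation Ω) : IsClosed (Vh 𝒯 : Set (L2 Ω × L2Vec Ω)) :=
  isClosed_H1.inter ((isClosed_Sh 𝒯).preimage continuous_fst)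

end Closed

/-! ### Solvability of one time step -/

section Step

variable {d : ℕ} {Ω : Set (Rd d)} {𝒯 : Triangulation Ω}

/-- `toL2` as a linear map. -/
noncomputable def toL2ₗ (𝒯 : Triangulation Ω) : Vh 𝒯 →ₗ[ℝ] L2 Ω :=
  LinearMap.fst ℝ (L2 Ω) (L2Vec Ω) ∘ₗ (Vh 𝒯).subtype

/-- `grad` as a linear map. -/
noncomputable def gradₗ (𝒯 : Triangulation Ω) : Vh 𝒯 →ₗ[ℝ] L2Vec Ω :=
  LinearMap.snd ℝ (L2 Ω) (L2Vec Ω) ∘ₗ (Vh 𝒯).subtype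

lemma toL2_sub (u v : Vh 𝒯) : toL2 (u - v) = toL2 u - toL2 v := rfl

lemma grad_sub (u v : Vh 𝒯) : grad (u - v) = grad u - grad v := rfl

lemma toL2_zero : toL2 (0 : Vh 𝒯) = 0 := rfl

lemma toL2_smul (c : ℝ) (u : Vh 𝒯) : toL2 (c • u) = c • toL2 u := rfl

lemma toL2_l1History (α : ℝ) (u : ℕ → Vh 𝒯) (m : ℕ) :
    toL2 (l1History α u m) = l1History α (fun k => toL2 (u k)) m :=
  map_l1History (toL2ₗ 𝒯) α u m

lemma eq_zero_of_toL2_grad {v : Vh 𝒯} (h1 : toL2 v = 0) (h2 : grad v = 0) : v = 0 :=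
  Subtype.ext (Prod.ext h1 h2)

/-- The map `v ↦ (a v, b ∇v)` into the Hilbert sum `L²(Ω) ⊕ L²(Ω; ℝᵈ)`, which pulls the inner
product of the latter back to `a²(u, v) + b²(∇u, ∇v)`. -/
noncomputable def energyMap (𝒯 : Triangulation Ω) (a b : ℝ) :
    Vh 𝒯 →ₗ[ℝ] WithLp 2 (L2 Ω × L2Vec Ω) :=
  (WithLp.linearEquiv 2 ℝ (L2 Ω × L2Vec Ω)).symm.toLinearMap ∘ₗ
    ((a • toL2ₗ 𝒯).prod (b • gradₗ 𝒯))

lemma energyMap_apply (a b : ℝ) (v : Vh 𝒯) :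
    energyMap 𝒯 a b v = WithLp.toLp 2 (a • toL2 v, b • grad v) := rfl

lemma inner_energyMap (a b : ℝ) (u v : Vh 𝒯) :
    inner ℝ (energyMap 𝒯 a b u) (energyMap 𝒯 a b v)
      = a ^ 2 * inner ℝ (toL2 u) (toL2 v) + b ^ 2 * inner ℝ (grad u) (grad v) := by
  simp only [energyMap_apply, WithLp.prod_inner_apply, real_inner_smul_left,
    real_inner_smul_right]
  ring

lemma isClosed_range_energyMap {a b : ℝ} (ha : a ≠ 0) (hb : b ≠ 0) :
    IsClosed (LinearMap.range (energyMap 𝒯 a b) : Set (WithLp 2 (L2 Ω × L2Vec Ω))) := by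
  have hset : (LinearMap.range (energyMap 𝒯 a b) : Set (WithLp 2 (L2 Ω × L2Vec Ω)))
      = (fun p => (a⁻¹ • p.fst, b⁻¹ • p.snd)) ⁻¹' (Vh 𝒯 : Set (L2 Ω × L2Vec Ω)) := by
    ext p
    constructor
    · rintro ⟨v, rfl⟩
      have : (a⁻¹ • (energyMap 𝒯 a b v).fst, b⁻¹ • (energyMap 𝒯 a b v).snd) = v.1 :=
        Prod.ext (inv_smul_smul₀ ha _) (inv_smul_smul₀ hb _)
      rw [mem_preimage, this]
      exact v.2
    · intro hp
      exact ⟨⟨_, hp⟩, congrArg (WithLp.toLp 2)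
        (Prod.ext (smul_inv_smul₀ ha _) (smul_inv_smul₀ hb _))⟩
  rw [hset]
  refine (isClosed_Vh 𝒯).preimage ?_
  fun_prop

/-- The Riesz representation of `χ ↦ (F, χ)` in `V_h` with the inner product
`a (u, χ) + b (∇u, ∇χ)`. -/
lemma exists_energy_solution (𝒯 : Triangulation Ω) {a b : ℝ} (ha : 0 < a) (hb : 0 < b) (F : L2 Ω) :
    ∃ u : Vh 𝒯, ∀ χ : Vh 𝒯,
      a * inner ℝ (toL2 u) (toL2 χ) + b * inner ℝ (grad u) (grad χ) = inner ℝ F (toL2 χ) := by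
  have ha' : √a ≠ 0 := (Real.sqrt_pos.2 ha).ne'
  have hb' : √b ≠ 0 := (Real.sqrt_pos.2 hb).ne'
  have hcl := isClosed_range_energyMap (𝒯 := 𝒯) ha' hb'
  set W := LinearMap.range (energyMap 𝒯 √a √b)
  have : CompleteSpace W := hcl.completeSpace_coe
  let p : WithLp 2 (L2 Ω × L2Vec Ω) := WithLp.toLp 2 ((√a)⁻¹ • F, 0)
  obtain ⟨u, hu⟩ : W.starProjection p ∈ W := W.starProjection_apply_mem p
  refine ⟨u, fun χ => ?_⟩
  have h := W.starProjection_inner_eq_zero p (energyMap 𝒯 √a √b χ) ⟨χ, rfl⟩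
  have hp : inner ℝ p (energyMap 𝒯 √a √b χ) = inner ℝ F (toL2 χ) := by
    simp only [p, energyMap_apply, WithLp.prod_inner_apply, real_inner_smul_left,
      real_inner_smul_right, inner_zero_left, add_zero]
    field_simp
  rw [inner_sub_left, ← hu, inner_energyMap, hp, Real.sq_sqrt ha.le, Real.sq_sqrt hb.le] at h
  linarith

end Step

/-! ### The two forms of the scheme -/

section Scheme

variable {d : ℕ} {Ω : Set (Rd d)} {𝒯 : Triangulation Ω} {α T : ℝ} {μ : ℝ → ℝ} {M : ℕ}
  {f g : L2 Ω} {u w : ℕ → Vh 𝒯}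

/-- The L1 equations multiplied by `b₀`, with arbitrary initial value. -/
lemma l1Equations_iff (hα1 : α < 1) (hT : 0 < T) :
    L1Equations 𝒯 α T μ M f u ↔ ∀ m < M, ∀ χ : Vh 𝒯,
      (1 + bZero α (T / M)) * inner ℝ (toL2 (u (m + 1))) (toL2 χ)
          + bZero α (T / M) * inner ℝ (grad (u (m + 1))) (grad χ)
        = inner ℝ (toL2 (l1History α u m)) (toL2 χ)
          + bZero α (T / M) * inner ℝ (μ ((m + 1 : ℕ) * (T / M)) • f) (toL2 χ) := by
  have key : ∀ m < M, ∀ χ : Vh 𝒯,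
      (inner ℝ (toL2 (l1Deriv α (T / M) u (m + 1))) (toL2 χ)
          + inner ℝ (grad (u (m + 1))) (grad χ) + inner ℝ (toL2 (u (m + 1))) (toL2 χ)
        = inner ℝ (μ ((m + 1 : ℕ) * (T / M)) • f) (toL2 χ)) ↔
      ((1 + bZero α (T / M)) * inner ℝ (toL2 (u (m + 1))) (toL2 χ)
          + bZero α (T / M) * inner ℝ (grad (u (m + 1))) (grad χ)
        = inner ℝ (toL2 (l1History α u m)) (toL2 χ)
          + bZero α (T / M) * inner ℝ (μ ((m + 1 : ℕ) * (T / M)) • f) (toL2 χ)) := by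
    intro m hm χ
    have hM : (0 : ℝ) < M := by exact_mod_cast (Nat.zero_le m).trans_lt hm
    have hb : bZero α (T / M) ≠ 0 := (bZero_pos hα1 (div_pos hT hM)).ne'
    have h := congrArg (fun v => inner ℝ (toL2 v) (toL2 χ)) (bZero_smul_l1Deriv_succ hb u m)
    simp only [toL2_smul, toL2_sub, real_inner_smul_left, inner_sub_left] at h
    rw [← mul_right_inj' hb, mul_add, mul_add, h]
    constructor <;> intro h' <;> linarith
  constructor
  · intro h m hm χ
    exact (key m hm χ).1 (h (m + 1) (by omega) (by omega) χ)
  · rintro h m hm1 hmM χ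
    obtain ⟨m, rfl⟩ : ∃ k, m = k + 1 := ⟨m - 1, by omega⟩
    exact (key m (by omega) χ).2 (h m (by omega) χ)

lemma isSteppingSolution_iff (hα1 : α < 1) (hT : 0 < T) :
    IsSteppingSolution 𝒯 α T μ M f u ↔ IsL1Solution 𝒯 α T μ M f u := by
  rw [IsSteppingSolution, IsL1Solution, l1Equations_iff hα1 hT]
  refine and_congr_right fun h0 => forall₃_congr fun m _ χ => ?_
  have : inner ℝ (toL2 (l1History α u m)) (toL2 χ) = ∑ j ∈ Finset.range m,
      (dCoeff α j - dCoeff α (j + 1)) * inner ℝ (toL2 (u (m - j))) (toL2 χ) := by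
    rw [toL2_l1History, l1History, h0, toL2_zero, smul_zero, add_zero, sum_inner]
    simp only [real_inner_smul_left]
  rw [this]

lemma L1Equations.sub (hα1 : α < 1) (hT : 0 < T) (hu : L1Equations 𝒯 α T μ M f u)
    (hw : L1Equations 𝒯 α T μ M g w) : L1Equations 𝒯 α T μ M (f - g) (u - w) := by
  rw [l1Equations_iff hα1 hT] at hu hw ⊢
  intro m hm χ
  have h1 := hu m hm χ
  have h2 := hw m hm χ
  simp only [l1History_sub, Pi.sub_apply, toL2_sub, grad_sub, smul_sub, inner_sub_left]
  linarith

/-- Time stepping from the initial value `0` with the solution operator `S`: the history of the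
sequence is read off in `Y` through `ι`, and `F m` is the source term of the step to `t_{m+1}`. -/
noncomputable def march {X : Type*} [Zero X] {Y : Type*} [AddCommGroup Y] [Module ℝ Y] (α : ℝ)
    (S : Y → X) (ι : X → Y) (F : ℕ → Y) : ℕ → X
  | 0 => 0
  | m + 1 => S (∑ j ∈ Finset.range m,
      (dCoeff α j - dCoeff α (j + 1)) • ι (march α S ι F (m - j)) + F m)

lemma exists_isL1Solution (𝒯 : Triangulation Ω) (hα1 : α < 1) (hT : 0 < T) (hM : 0 < M)
    (f : L2 Ω) : ∃ u : ℕ → Vh 𝒯, IsL1Solution 𝒯 α T μ M f u := by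
  have hb : 0 < bZero α (T / M) := bZero_pos hα1 (div_pos hT (by exact_mod_cast hM))
  choose S hS using exists_energy_solution 𝒯 (a := 1 + bZero α (T / M)) (by linarith) hb
  let F : ℕ → L2 Ω := fun m => bZero α (T / M) • μ ((m + 1 : ℕ) * (T / M)) • f
  refine ⟨march α S toL2 F, (isSteppingSolution_iff hα1 hT).1 ⟨by rw [march], fun m _ χ => ?_⟩⟩
  rw [march, hS, inner_add_left, sum_inner]
  simp only [F, real_inner_smul_left]

/-! ### Stability -/

/-- The time levels `t_1, …, t_M` lie in `[0, T]`. -/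
lemma norm_source_le (hT : 0 < T) {K : ℝ} (hμ : ∀ t ∈ Icc 0 T, |μ t| ≤ K) (f : L2 Ω) {m : ℕ}
    (hm : m < M) : ‖μ ((m + 1 : ℕ) * (T / M)) • f‖ ≤ K * ‖f‖ := by
  have hM : (0 : ℝ) < M := by exact_mod_cast (Nat.zero_le m).trans_lt hm
  rw [norm_smul, Real.norm_eq_abs]
  refine mul_le_mul_of_nonneg_right (hμ _ ⟨by positivity, ?_⟩) (norm_nonneg f)
  rw [mul_div_assoc', div_le_iff₀ hM, mul_comm]
  exact mul_le_mul_of_nonneg_left (by exact_mod_cast hm) hT.le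

/-- Stability in `L²(Ω)`, by testing with the solution itself. -/
lemma L1Equations.norm_toL2_le (hα0 : 0 < α) (hα1 : α < 1) (hT : 0 < T) {K : ℝ}
    (hμ : ∀ t ∈ Icc 0 T, |μ t| ≤ K) (hu : L1Equations 𝒯 α T μ M f u) :
    ∀ m ≤ M, ‖toL2 (u m)‖ ≤ ‖toL2 (u 0)‖ + K * ‖f‖ := by
  have hK : 0 ≤ K := (abs_nonneg _).trans (hμ 0 ⟨le_rfl, hT.le⟩)
  rw [l1Equations_iff hα1 hT] at hu
  intro m
  induction m using Nat.strong_induction_on with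
  | _ m ih =>
    intro hm
    rcases m with _ | m
    · linarith [mul_nonneg hK (norm_nonneg f)]
    have hM : (0 : ℝ) < M := by exact_mod_cast (Nat.zero_le m).trans_lt hm
    set b := bZero α (T / M)
    have hb : 0 < b := bZero_pos hα1 (div_pos hT hM)
    set R := ‖toL2 (u 0)‖ + K * ‖f‖
    have hhist : ‖toL2 (l1History α u m)‖ ≤ R := by
      rw [toL2_l1History]
      exact norm_l1History_le hα0 hα1 fun k hk => ih k (by omega) (by omega)
    have hsrc := norm_source_le hT hμ f hm
    have h := hu m hm (u (m + 1))
    rw [real_inner_self_eq_norm_sq, real_inner_self_eq_norm_sq] at h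
    set x := ‖toL2 (u (m + 1))‖
    have hx : 0 ≤ x := norm_nonneg _
    have h1 : inner ℝ (toL2 (l1History α u m)) (toL2 (u (m + 1))) ≤ R * x :=
      (real_inner_le_norm _ _).trans (mul_le_mul_of_nonneg_right hhist hx)
    have h2 : inner ℝ (μ ((m + 1 : ℕ) * (T / M)) • f) (toL2 (u (m + 1))) ≤ R * x := by
      refine (real_inner_le_norm _ _).trans (mul_le_mul_of_nonneg_right (hsrc.trans ?_) hx)
      linarith [norm_nonneg (toL2 (u 0))]
    have h3 := mul_le_mul_of_nonneg_left h2 hb.le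
    have h4 : 0 ≤ b * ‖grad (u (m + 1))‖ ^ 2 := by positivity
    by_contra hlt
    rw [not_le] at hlt
    have h5 : 0 < (1 + b) * (x * (x - R)) := by
      have : 0 < x := lt_of_le_of_lt (by positivity) hlt
      exact mul_pos (by linarith) (mul_pos this (by linarith))
    linarith

/-- Bound of the gradient for vanishing initial value, by testing with the discrete fractional
derivative of the solution. -/
lemma IsL1Solution.norm_grad_sq_le (hα0 : 0 < α) (hα1 : α < 1) (hT : 0 < T) {K : ℝ}
    (hμ : ∀ t ∈ Icc 0 T, |μ t| ≤ K) (hu : IsL1Solution 𝒯 α T μ M f u) {m : ℕ} (hm : m < M) :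
    ‖grad (u (m + 1))‖ ^ 2 ≤ Real.Gamma (2 - α) * T ^ α / (1 - α) * (K ^ 2 / 2) * ‖f‖ ^ 2 := by
  have hM : (0 : ℝ) < M := by exact_mod_cast (Nat.zero_le m).trans_lt hm
  set b := bZero α (T / M)
  have hb : 0 < b := bZero_pos hα1 (div_pos hT hM)
  set v : ℕ → WithLp 2 (L2 Ω × L2Vec Ω) := fun k => energyMap 𝒯 1 1 (u k) with hv
  have henergy : ∀ k < M, ‖v (k + 1)‖ ^ 2
      ≤ l1History α (fun k => ‖v k‖ ^ 2) k + b * (K ^ 2 / 2 * ‖f‖ ^ 2) := by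
    intro k hk
    set D := l1Deriv α (T / M) u (k + 1)
    have htest := hu.2 (k + 1) (by omega) (by omega) D
    have hinner := inner_energyMap 1 1 (u (k + 1)) D
    have hvD : v (k + 1) - l1History α v k = b • energyMap 𝒯 1 1 D := by
      rw [map_l1Deriv, bZero_smul_l1Deriv_succ hb.ne']
    have hconv := norm_sq_sub_l1History_le hα0 hα1 v k
    rw [hvD, real_inner_smul_right] at hconv
    have hsrc := norm_source_le hT hμ f hk
    have hF := real_inner_le_norm (μ ((k + 1 : ℕ) * (T / M)) • f) (toL2 D)
    have hF' := mul_le_mul_of_nonneg_right hsrc (norm_nonneg (toL2 D))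
    rw [real_inner_self_eq_norm_sq] at htest
    have hH1 : 2 * inner ℝ (v (k + 1)) (energyMap 𝒯 1 1 D) ≤ K ^ 2 / 2 * ‖f‖ ^ 2 := by
      -- Young's inequality absorbs `‖D‖²`: `s y ≤ y² + s²/4` with `s = K‖f‖`, `y = ‖D‖`.
      simp only [hv]
      nlinarith [sq_nonneg (2 * ‖toL2 D‖ - K * ‖f‖)]
    have := mul_le_mul_of_nonneg_left hH1 hb.le
    linarith
  have hv0 : ‖v 0‖ ^ 2 = 0 := by simp [hv, hu.1]
  have hcomp := mul_dCoeff_le_of_le_l1History hα0 hα1 (E := fun k => ‖v k‖ ^ 2) (by positivity)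
    hv0 henergy m hm
  have hd := dCoeff_pos hα0 hα1 m
  have hgrad : ‖grad (u (m + 1))‖ ^ 2 ≤ ‖v (m + 1)‖ ^ 2 := by
    rw [← real_inner_self_eq_norm_sq (v (m + 1)), inner_energyMap, real_inner_self_eq_norm_sq,
      real_inner_self_eq_norm_sq]
    nlinarith [sq_nonneg ‖toL2 (u (m + 1))‖]
  refine hgrad.trans (le_of_mul_le_mul_right (hcomp.trans ?_) hd)
  have := mul_le_mul_of_nonneg_right (bZero_le_mul_dCoeff hα0 hα1 hT hm)
    (by positivity : 0 ≤ K ^ 2 / 2 * ‖f‖ ^ 2)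
  linarith

/-- The stability bounds for the difference of two solutions, whose source and initial value
vanish. -/
lemma IsL1Solution.eq (hα0 : 0 < α) (hα1 : α < 1) (hT : 0 < T) {K : ℝ}
    (hμ : ∀ t ∈ Icc 0 T, |μ t| ≤ K) (hu : IsL1Solution 𝒯 α T μ M f u)
    (hw : IsL1Solution 𝒯 α T μ M f w) : ∀ m ≤ M, u m = w m := by
  have hsub : IsL1Solution 𝒯 α T μ M 0 (u - w) := by
    refine ⟨by rw [Pi.sub_apply, hu.1, hw.1, sub_zero], ?_⟩
    have := hu.2.sub hα1 hT hw.2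
    rwa [sub_self] at this
  intro m hm
  rcases m with _ | m
  · rw [hu.1, hw.1]
  refine sub_eq_zero.1 (eq_zero_of_toL2_grad ?_ ?_)
  · have h := hsub.2.norm_toL2_le hα0 hα1 hT hμ (m + 1) hm
    rw [hsub.1, toL2_zero] at h
    simpa using h
  · have h := hsub.norm_grad_sq_le hα0 hα1 hT hμ hm
    rw [norm_zero, zero_pow two_ne_zero, mul_zero] at h
    exact norm_eq_zero.1 (pow_eq_zero_iff two_ne_zero |>.1 (le_antisymm h (sq_nonneg _)))

end Scheme

end L1Galerkin

theorem lemma3p3 (d : ℕ) (hd1 : 1 ≤ d) (hd3 : d ≤ 3)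
    (Ω : Set (L1Galerkin.Rd d)) (hΩ : L1Galerkin.IsConvexPolygonalDomain Ω)
    (α : ℝ) (hα0 : 0 < α) (hα1 : α < 1) (T : ℝ) (hT : 0 < T)
    (μ : ℝ → ℝ) (hμ : Bornology.IsBounded (μ '' Set.Icc 0 T)) :
    -- the two forms of the scheme are equivalent and determine `u_h^m(f_h)` uniquely
    (∀ (𝒯 : L1Galerkin.Triangulation Ω) (M : ℕ), 0 < M → ∀ f ∈ L1Galerkin.Sh 𝒯,
      (∀ u : ℕ → L1Galerkin.Vh 𝒯, L1Galerkin.IsSteppingSolution 𝒯 α T μ M f u ↔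
        L1Galerkin.IsL1Solution 𝒯 α T μ M f u) ∧
      (∃ u : ℕ → L1Galerkin.Vh 𝒯, L1Galerkin.IsL1Solution 𝒯 α T μ M f u) ∧
      (∀ u w : ℕ → L1Galerkin.Vh 𝒯, L1Galerkin.IsL1Solution 𝒯 α T μ M f u →
        L1Galerkin.IsL1Solution 𝒯 α T μ M f w → ∀ m ≤ M, u m = w m)) ∧
    L1Galerkin.UnconditionallyStable Ω α T μ ∧
    ∃ C₀ C₁ : ℝ, 0 < C₀ ∧ 0 < C₁ ∧
      ∀ (𝒯 : L1Galerkin.Triangulation Ω) (M : ℕ), 0 < M → ∀ f ∈ L1Galerkin.Sh 𝒯,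
        ∀ u : ℕ → L1Galerkin.Vh 𝒯, L1Galerkin.IsL1Solution 𝒯 α T μ M f u →
          ∀ m : ℕ, 1 ≤ m → m ≤ M →
            ‖L1Galerkin.toL2 (u m)‖ ≤ C₀ * ‖f‖ ∧
            ‖L1Galerkin.grad (u m)‖ ^ 2 ≤ C₁ * ‖f‖ ^ 2 := by
  obtain ⟨K₀, hK₀⟩ := hμ.exists_norm_le
  -- The bound is made positive, since the constants of the theorem are.
  obtain ⟨K, hK, hμK⟩ : ∃ K : ℝ, 0 < K ∧ ∀ t ∈ Icc 0 T, |μ t| ≤ K :=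
    ⟨max K₀ 1, by positivity, fun t ht => (hK₀ _ (mem_image_of_mem μ ht)).trans (le_max_left _ _)⟩
  have hΓ : 0 < Real.Gamma (2 - α) := Real.Gamma_pos_of_pos (by linarith)
  have h1α : 0 < 1 - α := by linarith
  refine ⟨fun 𝒯 M hM f _ => ⟨fun u => L1Galerkin.isSteppingSolution_iff hα1 hT,
    L1Galerkin.exists_isL1Solution 𝒯 hα1 hT hM f,
    fun u w hu hw => hu.eq hα0 hα1 hT hμK hw⟩, ?_, ?_⟩
  · refine ⟨max 1 K, by positivity, fun 𝒯 M _ f _ g _ u w hu hw m _ hm => ?_⟩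
    have h := (hu.sub hα1 hT hw).norm_toL2_le hα0 hα1 hT hμK m hm
    simp only [Pi.sub_apply, L1Galerkin.toL2_sub] at h
    rw [mul_add]
    refine h.trans (add_le_add (le_mul_of_one_le_left (norm_nonneg _) (le_max_left _ _)) ?_)
    exact mul_le_mul_of_nonneg_right (le_max_right _ _) (norm_nonneg _)
  · refine ⟨K, Real.Gamma (2 - α) * T ^ α / (1 - α) * (K ^ 2 / 2), hK, by positivity,
      fun 𝒯 M _ f _ u hu m hm1 hm => ⟨?_, ?_⟩⟩
    · have h := hu.2.norm_toL2_le hα0 hα1 hT hμK m hm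
      rwa [hu.1, L1Galerkin.toL2_zero, norm_zero, zero_add] at h
    · obtain ⟨k, rfl⟩ : ∃ k, m = k + 1 := ⟨m - 1, by omega⟩
      exact hu.norm_grad_sq_le hα0 hα1 hT hμK hm
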